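/- **Conventions.** Fix a set $V$ of node labels. A *graph* is a pair $G=(G^E,G^V)$ of a Boolean $V\times V$ matrix (edges) and a Boolean vector on $V$ (nodes). The operations $\vee$, $\wedge$ (written as a product) and $\overline{\phantom{x}}$ act entrywise, on edges and nodes alike. $G$ is a *simple digraph* if it has no dangling edge, i.e. every edge of $G$ joins two nodes of $G$. A *production* $p:L\to R$ is given by graphs $L,e,r$ with $e\le L$ and $rL=0$ such that $L$ and $R=r\vee\overline e L$ are simple digraphs; it acts on graphs by $p(G)=r\vee\overline e\,G$. Let $N=L^V\vee R^V$ be the nodes that occur in $p$. On the nodes of $N$, let $\overline D$ be the set of edges $(i,j)\in N\times N$ with $i$ or $j$ deleted by $p$, and $T$ the set of edges $(i,j)\in N\times N$ with $i$ or $j$ added and neither of them deleted by $p$ (both are completed by zeros outside $N\times N$, and have no node part). Put $K=r\vee\overline e\,\overline D$ (so that $K^V=r^V$) and $Q=e\vee\overline r K$. For a family $F(x,y)$ put $$\nabla_a^b F(x,y)=\bigvee_{y=a}^b\bigwedge_{x=a}^y F(x,y),\qquad \triangle_a^b F(x,y)=\bigvee_{y=a}^b\bigwedge_{x=y}^b F(x,y).$$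 A pair $a\vee i\,b$ of graphs has certainty part $a$ and nihil part $b$; it is $0$ if $a=b=0$. Let $s=p_n;\dots;p_1$, $n\ge 1$, be a sequence of productions over $V$ ($p_1$ is applied first), with data $L_j,e_j,r_j,R_j,K_j,Q_j,T_j$. * Its *initial digraph* is $M(s)=M_C(s)\vee i\,M_N(s)$ with $M_C(s)=\nabla_1^n\,\overline r_xL_y$ and $M_N(s)=\nabla_1^n\,\overline e_x\overline T_xK_y$. Two sequences are *G-congruent* if they have the same initial digraph, i.e. the same certainty part and the same nihil part, for edges and for nodes. * $s$ is *coherent* if $C^+\vee i\,C^-=0$, where $$C^+=\bigvee_{j=1}^n\left(R_j\nabla_{j+1}^n(\overline e_xr_y)\vee L_j\triangle_1^{j-1}(e_y\overline r_x)\right),\qquad C^-=\bigvee_{j=1}^n\left(Q_j\nabla_{j+1}^n(e_y\overline r_x)\vee K_j\triangle_1^{j-1}(r_y\overline e_x)\right).$$ * $s$ is *compatible* if for each $1\le m\le n$ the image $p_m(\cdots p_1(M_C(p_m;\dots;p_1))\cdots)$ is a simple digraph. The *advancement* and the *delay* of $s$ are $\phi(s)=p_{n-1};\dots;p_1;p_n$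 and $\delta(s)=p_1;p_n;\dots;p_2$. **Theorem (G-congruence).** 1. Suppose that $\phi(s)$ is coherent and compatible. If $F^+\vee i\,F^-=0$, where $$F^+=L_n\nabla_1^{n-1}\left(\overline e_xK_y(r_y\vee e_n)\right),\qquad F^-=K_n\nabla_1^{n-1}\left(\overline r_xL_y(e_y\vee r_n)\right),$$ then $s$ and $\phi(s)$ are G-congruent. 2. Suppose that $s$ is coherent and compatible. If $D^+\vee i\,D^-=0$, where $$D^+=L_1\nabla_2^{n}\left(\overline e_xK_y(r_y\vee e_1)\right),\qquad D^-=K_1\nabla_2^{n}\left(\overline r_xL_y(e_y\vee r_1)\right),$$ then $s$ and $\delta(s)$ are G-congruent. -/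

import Mathlib

namespace MGG

noncomputable section

/-- A pair (Boolean edge matrix, Boolean node vector) over the set `V` of all node labels of the
completed sequence. It is a Boolean algebra componentwise, so that a formula written for `BGraph V`
is applied to edges and to nodes at the same time. -/
abbrev BGraph (V : Type*) := (V → V → Prop) × (V → Prop)

/-- No dangling edges: every edge joins two nodes that are present. -/
def IsSimpleDigraph {V : Type*} (G : BGraph V) : Prop :=
  ∀ i j, G.1 i j → G.2 i ∧ G.2 j

/-- The tensor (Kronecker) product of two node vectors. -/
def tensor {V : Type*} (a b : V → Prop) : V → V → Prop := fun i j => a i ∧ b j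

/-- A Boolean complex `a ∨ i b` with certainty part `a` and nihil part `b`. -/
@[ext]
structure BoolComplex (α : Type*) where
  cert : α
  nihil : α

instance {α : Type*} [Bot α] : Zero (BoolComplex α) := ⟨⟨⊥, ⊥⟩⟩

/-- A production `p : L → R` in its dynamic formulation: left hand side `L`, deleted elements `e`,
added elements `r`. Deleted elements belong to `L`, added ones do not, and both `L` and
`R = r ∨ ē L` are simple digraphs. -/
structure Production (V : Type*) where
  L : BGraph V
  e : BGraph V
  r : BGraph V
  e_le_L : e ≤ L
  r_inf_L : r ⊓ L = ⊥
  simple_L : IsSimpleDigraph L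
  simple_R : IsSimpleDigraph (r ⊔ eᶜ ⊓ L)

namespace Production

variable {V : Type*} (p : Production V)

/-- The action of the production on a graph: `p(G) = r ∨ ē G`. -/
def apply (G : BGraph V) : BGraph V := p.r ⊔ p.eᶜ ⊓ G

/-- The right hand side. -/
def R : BGraph V := p.apply p.L

/-- The nodes that occur in the production, i.e. in `L` or in `R`. The matrices of the production
are formed on these nodes and completed with zero rows and columns. -/
def nodes : V → Prop := p.L.2 ⊔ p.R.2

/-- `D̄`, the negation of `ē ⊗ ēᵗ` on the nodes of the production: the edges incident to a deleted
node. It has no node component. -/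
def Dbar : BGraph V := (tensor p.nodes p.nodes ⊓ (tensor p.e.2ᶜ p.e.2ᶜ)ᶜ, ⊥)

/-- The nihilation part `K = p(D̄) = r ∨ ē D̄`. -/
def K : BGraph V := p.apply p.Dbar

/-- The nihilation part of the right hand side, `Q = p⁻¹(K) = e ∨ r̄ K`. -/
def Q : BGraph V := p.e ⊔ p.rᶜ ⊓ p.K

/-- `T`, the edges between nodes of the production that become available because a node is added:
the conjunction of the negation of `r̄ ⊗ r̄ᵗ` with `ē ⊗ ēᵗ`. It has no node component. -/
def T : BGraph V :=
  (tensor p.nodes p.nodes ⊓ (tensor p.r.2ᶜ p.r.2ᶜ)ᶜ ⊓ tensor p.e.2ᶜ p.e.2ᶜ, ⊥)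

end Production

/-- `△_a^b F(x,y) = ⋁_{y=a}^b ⋀_{x=y}^b F(x,y)`. -/
def upTri {α : Type*} [BooleanAlgebra α] (a b : ℕ) (F : ℕ → ℕ → α) : α :=
  (Finset.Icc a b).sup fun y => (Finset.Icc y b).inf fun x => F x y

/-- `∇_a^b F(x,y) = ⋁_{y=a}^b ⋀_{x=a}^y F(x,y)`. -/
def nabla {α : Type*} [BooleanAlgebra α] (a b : ℕ) (F : ℕ → ℕ → α) : α :=
  (Finset.Icc a b).sup fun y => (Finset.Icc a y).inf fun x => F x y

section Sequences

variable {V : Type*}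

/-! A completed sequence `s = p_n; …; p_1` (`p_1` is applied first) is a natural number `n` with a
function `s`, where `s k` is the production at position `k`; only `s 1, …, s n` matter. -/

/-- Advancement: `φ(s) = p_{n-1}; …; p_1; p_n`. -/
def advance (n : ℕ) (s : ℕ → Production V) : ℕ → Production V :=
  fun k => if k = 1 then s n else s (k - 1)

/-- Delay: `δ(s) = p_1; p_n; …; p_2`. -/
def delay (n : ℕ) (s : ℕ → Production V) : ℕ → Production V :=
  fun k => if k = n then s 1 else s (k + 1)

/-- The initial digraph `M(s) = ∇_1^n (r̄_x L_y ∨ i ē_x T̄_x K_y)`: its certainty part is the minimal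
initial digraph, its nihil part the negative initial digraph. -/
def initialDigraph (n : ℕ) (s : ℕ → Production V) : BoolComplex (BGraph V) where
  cert := nabla 1 n fun x y => (s x).rᶜ ⊓ (s y).L
  nihil := nabla 1 n fun x y => (s x).eᶜ ⊓ (s x).Tᶜ ⊓ (s y).K

/-- Two sequences of length `n` (one a permutation of the other) are G-congruent if they have the
same initial digraph, in the certainty part and in the nihil part, for edges and for nodes. -/
def GCongruent (n : ℕ) (s s' : ℕ → Production V) : Prop :=
  initialDigraph n s = initialDigraph n s'

/-- The coherence term `C = C⁺ ∨ i C⁻`. -/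
def coherenceTerm (n : ℕ) (s : ℕ → Production V) : BoolComplex (BGraph V) where
  cert := (Finset.Icc 1 n).sup fun j =>
    (s j).R ⊓ nabla (j + 1) n (fun x y => (s x).eᶜ ⊓ (s y).r) ⊔
      (s j).L ⊓ upTri 1 (j - 1) (fun x y => (s y).e ⊓ (s x).rᶜ)
  nihil := (Finset.Icc 1 n).sup fun j =>
    (s j).Q ⊓ nabla (j + 1) n (fun x y => (s y).e ⊓ (s x).rᶜ) ⊔
      (s j).K ⊓ upTri 1 (j - 1) (fun x y => (s y).r ⊓ (s x).eᶜ)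

/-- Coherence: no production prevents the actions of those applied after it. -/
def Coherent (n : ℕ) (s : ℕ → Production V) : Prop := coherenceTerm n s = 0

/-- The result of applying `s 1, …, s m` in this order to a graph. -/
def run (s : ℕ → Production V) : ℕ → BGraph V → BGraph V
  | 0, G => G
  | m + 1, G => (s (m + 1)).apply (run s m G)

/-- Compatibility: for every `m ≤ n` the image of the minimal initial digraph of `p_m; …; p_1`
under that sequence has no dangling edges. -/
def Compatible (n : ℕ) (s : ℕ → Production V) : Prop :=
  ∀ m, 1 ≤ m → m ≤ n → IsSimpleDigraph (run s m (initialDigraph m s).cert)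

/-- The term `F⁺ ∨ i F⁻` of the advancement. -/
def advanceTerm (n : ℕ) (s : ℕ → Production V) : BoolComplex (BGraph V) where
  cert := (s n).L ⊓ nabla 1 (n - 1) fun x y => (s x).eᶜ ⊓ (s y).K ⊓ ((s y).r ⊔ (s n).e)
  nihil := (s n).K ⊓ nabla 1 (n - 1) fun x y => (s x).rᶜ ⊓ (s y).L ⊓ ((s y).e ⊔ (s n).r)

/-- The term `D⁺ ∨ i D⁻` of the delay. -/
def delayTerm (n : ℕ) (s : ℕ → Production V) : BoolComplex (BGraph V) where
  cert := (s 1).L ⊓ nabla 2 n fun x y => (s x).eᶜ ⊓ (s y).K ⊓ ((s y).r ⊔ (s 1).e)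
  nihil := (s 1).K ⊓ nabla 2 n fun x y => (s x).rᶜ ⊓ (s y).L ⊓ ((s y).e ⊔ (s 1).r)

end Sequences

end

end MGG

namespace MGG

variable {V : Type*}

/-! Advancing is inverse to delaying, and the delay term of `advance n s` is the advancement term of
`s`, so only the delay needs an argument. It is made entry by entry, at a fixed edge or node. Let P
say that a production does not block the entry (no `r` for certainty; no `e` and no `T` for nihil),
Q that it requires the entry (`L`, resp. `K`), and Z that some production among positions 2 to n
requires it with no blocking from 2 up to it. Then M(s) reads P₁ ∧ (Q₁ ∨ Z) and M(δ(s)) reads Z ∨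
(P₁ ∧ Q₁ ∧ all later P). They differ only if Z holds with P₁ false, or if P₁ and Q₁ hold, Z fails
and some later P fails. Blocking by `r` or `e` contradicts the delay term (`cert_delay`,
`nihil_delay`). Blocking by `T` concerns edges and is settled at their end nodes: nodes added or
deleted by p₁ occur in no later production (`not_nodes_of_r`, `not_nodes_of_e`), and compatibility
protects the ends of an edge that p₁ adds (`not_T_of_K_one`). -/

/-- The value of a graph at an edge or at a node. -/
def eval : (V × V) ⊕ V → BGraph V → Prop
  | .inl c, G => G.1 c.1 c.2
  | .inr i, G => G.2 i

theorem eval_sup (c : (V × V) ⊕ V) (G H : BGraph V) :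
    eval c (G ⊔ H) ↔ eval c G ∨ eval c H := by
  cases c <;> rfl

theorem eval_inf (c : (V × V) ⊕ V) (G H : BGraph V) :
    eval c (G ⊓ H) ↔ eval c G ∧ eval c H := by
  cases c <;> rfl

theorem eval_compl (c : (V × V) ⊕ V) (G : BGraph V) : eval c Gᶜ ↔ ¬ eval c G := by
  cases c <;> rfl

theorem eval_bot (c : (V × V) ⊕ V) : eval c (⊥ : BGraph V) ↔ False := by
  cases c <;> rfl

theorem eval_top (c : (V × V) ⊕ V) : eval c (⊤ : BGraph V) ↔ True := by
  cases c <;> rfl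

theorem eval_mono {G H : BGraph V} (h : G ≤ H) (c : (V × V) ⊕ V) (hc : eval c G) :
    eval c H := by
  cases c with
  | inl c => exact h.1 c.1 c.2 hc
  | inr i => exact h.2 i hc

theorem eval_ext {G H : BGraph V} (h : ∀ c, eval c G ↔ eval c H) : G = H := by
  refine Prod.ext ?_ ?_
  · funext i j
    exact propext (h (.inl (i, j)))
  · funext i
    exact propext (h (.inr i))

theorem eval_finset_sup {ι : Type*} (c : (V × V) ⊕ V) (s : Finset ι) (f : ι → BGraph V) :
    eval c (s.sup f) ↔ ∃ y ∈ s, eval c (f y) := by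
  classical
  induction s using Finset.induction_on with
  | empty => simp [eval_bot]
  | insert a s _ ih => simp [eval_sup, ih]

theorem eval_finset_inf {ι : Type*} (c : (V × V) ⊕ V) (s : Finset ι) (f : ι → BGraph V) :
    eval c (s.inf f) ↔ ∀ y ∈ s, eval c (f y) := by
  classical
  induction s using Finset.induction_on with
  | empty => simp [eval_top]
  | insert a s _ ih => simp [eval_inf, ih]

theorem eval_nabla (c : (V × V) ⊕ V) (a b : ℕ) (F : ℕ → ℕ → BGraph V) :
    eval c (nabla a b F) ↔
      ∃ y, (a ≤ y ∧ y ≤ b) ∧ ∀ x, a ≤ x → x ≤ y → eval c (F x y) := by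
  simp [nabla, eval_finset_sup, eval_finset_inf]

theorem eval_upTri (c : (V × V) ⊕ V) (a b : ℕ) (F : ℕ → ℕ → BGraph V) :
    eval c (upTri a b F) ↔
      ∃ y, (a ≤ y ∧ y ≤ b) ∧ ∀ x, y ≤ x → x ≤ b → eval c (F x y) := by
  simp [upTri, eval_finset_sup, eval_finset_inf]

theorem nabla_congr {a b : ℕ} {F F' : ℕ → ℕ → BGraph V}
    (h : ∀ x y, a ≤ x → x ≤ y → y ≤ b → F x y = F' x y) : nabla a b F = nabla a b F' := by
  refine Finset.sup_congr rfl fun y hy => Finset.inf_congr rfl fun x hx => ?_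
  rw [Finset.mem_Icc] at hx hy
  exact h x y hx.1 hx.2 hy.2

theorem nabla_succ_succ (a b : ℕ) (F : ℕ → ℕ → BGraph V) :
    nabla (a + 1) (b + 1) F = nabla a b fun x y => F (x + 1) (y + 1) := by
  refine eval_ext fun c => ?_
  rw [eval_nabla, eval_nabla]
  constructor
  · rintro ⟨y, hy, h⟩
    refine ⟨y - 1, by omega, fun x h1 h2 => ?_⟩
    rw [Nat.sub_add_cancel (by omega)]
    exact h _ (by omega) (by omega)
  · rintro ⟨y, hy, h⟩
    refine ⟨y + 1, by omega, fun x h1 h2 => ?_⟩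
    have := h (x - 1) (by omega) (by omega)
    rwa [Nat.sub_add_cancel (by omega)] at this

/-! ### Prefix conditions under delay -/

/-- Splitting off the first production of a sequence. -/
theorem exists_prefix_iff_first {n : ℕ} (hn : 1 ≤ n) (s : ℕ → Production V)
    (P Q : Production V → Prop) :
    (∃ y, (1 ≤ y ∧ y ≤ n) ∧ ∀ x, 1 ≤ x → x ≤ y → P (s x) ∧ Q (s y)) ↔
      P (s 1) ∧ (Q (s 1) ∨ ∃ y, (2 ≤ y ∧ y ≤ n) ∧ ∀ x, 2 ≤ x → x ≤ y → P (s x) ∧ Q (s y)) := by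
  constructor
  · rintro ⟨y, hy, h⟩
    refine ⟨(h 1 le_rfl hy.1).1, ?_⟩
    rcases hy.1.eq_or_lt with rfl | h1
    · exact .inl (h 1 le_rfl le_rfl).2
    · exact .inr ⟨y, ⟨h1, hy.2⟩, fun x hx => h x (by omega)⟩
  · rintro ⟨hP, hQ | ⟨y, hy, h⟩⟩
    · refine ⟨1, ⟨le_rfl, hn⟩, fun x h1 h2 => ?_⟩
      obtain rfl : x = 1 := by omega
      exact ⟨hP, hQ⟩
    · refine ⟨y, by omega, fun x h1 h2 => ?_⟩
      rcases h1.eq_or_lt with rfl | h1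
      · exact ⟨hP, (h y hy.1 le_rfl).2⟩
      · exact h x h1 h2

/-- Splitting off the last production of a delayed sequence. -/
theorem exists_prefix_delay_iff {n : ℕ} (hn : 1 ≤ n) (s : ℕ → Production V)
    (P Q : Production V → Prop) :
    (∃ y, (1 ≤ y ∧ y ≤ n) ∧ ∀ x, 1 ≤ x → x ≤ y → P (delay n s x) ∧ Q (delay n s y)) ↔
      (∃ y, (2 ≤ y ∧ y ≤ n) ∧ ∀ x, 2 ≤ x → x ≤ y → P (s x) ∧ Q (s y)) ∨
        (P (s 1) ∧ Q (s 1) ∧ ∀ x, 2 ≤ x → x ≤ n → P (s x)) := by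
  have hlt : ∀ k, k < n → delay n s k = s (k + 1) := fun k hk => if_neg hk.ne
  have hlast : delay n s n = s 1 := if_pos rfl
  have hpred : ∀ k, 2 ≤ k → k ≤ n → delay n s (k - 1) = s k := fun k h1 h2 => by
    rw [hlt _ (by omega), Nat.sub_add_cancel (by omega)]
  constructor
  · rintro ⟨y, hy, h⟩
    rcases hy.2.eq_or_lt with rfl | h1
    · refine .inr ⟨?_, ?_, fun x h2 h3 => ?_⟩
      · have := (h y hn le_rfl).1
        rwa [hlast] at this
      · have := (h y hn le_rfl).2
        rwa [hlast] at this
      · have := (h (x - 1) (by omega) (by omega)).1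
        rwa [hpred x h2 h3] at this
    · refine .inl ⟨y + 1, by omega, fun x h2 h3 => ?_⟩
      have := h (x - 1) (by omega) (by omega)
      rwa [hpred x h2 (by omega), hlt y h1] at this
  · rintro (⟨y, hy, h⟩ | ⟨hP, hQ, h⟩)
    · refine ⟨y - 1, by omega, fun x h2 h3 => ?_⟩
      rw [hpred y hy.1 hy.2, hlt x (by omega)]
      exact h _ (by omega) (by omega)
    · refine ⟨n, ⟨hn, le_rfl⟩, fun x h2 h3 => ?_⟩
      rw [hlast]
      refine ⟨?_, hQ⟩
      rcases h3.eq_or_lt with rfl | h3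
      · rwa [hlast]
      · rw [hlt x h3]
        exact h _ (by omega) (by omega)

/-- A property that holds somewhere in an interval starting at `2` holds there for a first time. -/
theorem exists_first {P : ℕ → Prop} {n y : ℕ} (h2 : 2 ≤ y) (hn : y ≤ n) (hy : P y) :
    ∃ z, 2 ≤ z ∧ z ≤ n ∧ z ≤ y ∧ P z ∧ ∀ x, 2 ≤ x → x < z → ¬ P x := by
  classical
  have hex : ∃ k, 2 ≤ k ∧ P k := ⟨y, h2, hy⟩
  have hle : Nat.find hex ≤ y := Nat.find_min' hex ⟨h2, hy⟩
  exact ⟨Nat.find hex, (Nat.find_spec hex).1, hle.trans hn, hle, (Nat.find_spec hex).2,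
    fun x hx hlt hP => Nat.find_min hex hlt ⟨hx, hP⟩⟩

/-! ### Entries of a single production -/

namespace Production

variable (p : Production V) {c : (V × V) ⊕ V} {i j : V}

theorem eval_L_of_e (h : eval c p.e) : eval c p.L := eval_mono p.e_le_L c h

theorem not_eval_L_of_r (h : eval c p.r) : ¬ eval c p.L := fun hL =>
  (eval_bot c).1 (p.r_inf_L ▸ (eval_inf c _ _).2 ⟨h, hL⟩)

theorem not_eval_e_of_r (h : eval c p.r) : ¬ eval c p.e := fun he =>
  p.not_eval_L_of_r h (p.eval_L_of_e he)

theorem eval_R : eval c p.R ↔ eval c p.r ∨ ¬ eval c p.e ∧ eval c p.L := by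
  simp [R, apply, eval_sup, eval_inf, eval_compl]

theorem eval_K : eval c p.K ↔ eval c p.r ∨ ¬ eval c p.e ∧ eval c p.Dbar := by
  simp [K, apply, eval_sup, eval_inf, eval_compl]

theorem eval_K_of_r (h : eval c p.r) : eval c p.K := p.eval_K.2 (.inl h)

theorem eval_nodes : p.nodes i ↔ eval (.inr i) p.L ∨ eval (.inr i) p.r := by
  have : p.nodes i ↔ eval (.inr i) p.L ∨ eval (.inr i) p.R := Iff.rfl
  rw [this, eval_R]
  tauto

theorem Dbar_edge : eval (.inl (i, j)) p.Dbar ↔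
    (p.nodes i ∧ p.nodes j) ∧ (eval (.inr i) p.e ∨ eval (.inr j) p.e) := by
  have : eval (.inl (i, j)) p.Dbar ↔
      (p.nodes i ∧ p.nodes j) ∧ ¬ (¬ eval (.inr i) p.e ∧ ¬ eval (.inr j) p.e) := Iff.rfl
  rw [this]
  tauto

theorem T_edge : eval (.inl (i, j)) p.T ↔
    (p.nodes i ∧ p.nodes j) ∧ (eval (.inr i) p.r ∨ eval (.inr j) p.r) ∧
      ¬ eval (.inr i) p.e ∧ ¬ eval (.inr j) p.e := by
  have : eval (.inl (i, j)) p.T ↔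
      ((p.nodes i ∧ p.nodes j) ∧ ¬ (¬ eval (.inr i) p.r ∧ ¬ eval (.inr j) p.r)) ∧
      ¬ eval (.inr i) p.e ∧ ¬ eval (.inr j) p.e := Iff.rfl
  rw [this]
  tauto

theorem not_T_node : ¬ eval (.inr i) p.T := fun h => h

theorem R_node_of_r_edge (h : eval (.inl (i, j)) p.r) :
    eval (.inr i) p.R ∧ eval (.inr j) p.R :=
  p.simple_R i j (p.eval_R.2 (.inl h))

/-- Added edges have their ends in `R`, which is simple; `Dbar` is confined to the nodes by
definition. -/
theorem nodes_of_K_edge (h : eval (.inl (i, j)) p.K) : p.nodes i ∧ p.nodes j := by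
  rcases p.eval_K.1 h with h | h
  · exact ⟨.inr (p.R_node_of_r_edge h).1, .inr (p.R_node_of_r_edge h).2⟩
  · exact (p.Dbar_edge.1 h.2).1

end Production

open Production

/-! ### Consequences of coherence, compatibility and the delay term -/

section Delay

variable {n : ℕ} {s : ℕ → Production V}

/-- No production after `x` re-adds an element of `R_x` that was not deleted in between. -/
theorem Coherent.not_r (h : Coherent n s) (c : (V × V) ⊕ V) {x y : ℕ} (hx : 1 ≤ x) (hxy : x < y)
    (hy : y ≤ n) (hR : eval c (s x).R) (he : ∀ z, x < z → z < y → ¬ eval c (s z).e) :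
    ¬ eval c (s y).r := by
  intro hr
  have h0 : (coherenceTerm n s).cert = ⊥ := congrArg BoolComplex.cert h
  refine (eval_bot c).1 (h0 ▸ ?_)
  simp only [coherenceTerm, eval_finset_sup, eval_sup, eval_inf, eval_nabla, eval_compl,
    Finset.mem_Icc]
  refine ⟨x, ⟨hx, by omega⟩, .inl ⟨hR, y, ⟨hxy, hy⟩, fun z h1 h2 => ⟨?_, hr⟩⟩⟩
  -- The inner conjunction includes the endpoint `y`, where adding excludes deleting.
  rcases h2.eq_or_lt with rfl | h2
  · exact not_eval_e_of_r _ hr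
  · exact he z h1 h2

/-- No production after `x` uses an element deleted by `x` that was not re-added in between. -/
theorem Coherent.not_L (h : Coherent n s) (c : (V × V) ⊕ V) {x y : ℕ} (hx : 1 ≤ x) (hxy : x < y)
    (hy : y ≤ n) (he : eval c (s x).e) (hr : ∀ z, x < z → z < y → ¬ eval c (s z).r) :
    ¬ eval c (s y).L := by
  intro hL
  have h0 : (coherenceTerm n s).cert = ⊥ := congrArg BoolComplex.cert h
  refine (eval_bot c).1 (h0 ▸ ?_)
  simp only [coherenceTerm, eval_finset_sup, eval_sup, eval_inf, eval_upTri, eval_compl,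
    Finset.mem_Icc]
  refine ⟨y, ⟨by omega, hy⟩, .inr ⟨hL, x, ⟨hx, by omega⟩, fun z h1 h2 => ⟨he, ?_⟩⟩⟩
  rcases h1.eq_or_lt with rfl | h1
  · exact fun hr => not_eval_e_of_r _ hr he
  · exact hr z h1 (by omega)

theorem delayTerm_cert (h : delayTerm n s = 0) (c : (V × V) ⊕ V) {y : ℕ} (h2 : 2 ≤ y) (hy : y ≤ n)
    (hL : eval c (s 1).L) (he : ∀ x, 2 ≤ x → x ≤ y → ¬ eval c (s x).e) (hK : eval c (s y).K)
    (hre : eval c (s y).r ∨ eval c (s 1).e) : False := by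
  have h0 : (delayTerm n s).cert = ⊥ := congrArg BoolComplex.cert h
  refine (eval_bot c).1 (h0 ▸ ?_)
  simp only [delayTerm, eval_sup, eval_inf, eval_nabla, eval_compl]
  exact ⟨hL, y, ⟨h2, hy⟩, fun x h1 h3 => ⟨⟨he x h1 h3, hK⟩, hre⟩⟩

theorem delayTerm_nihil (h : delayTerm n s = 0) (c : (V × V) ⊕ V) {y : ℕ} (h2 : 2 ≤ y) (hy : y ≤ n)
    (hK : eval c (s 1).K) (hr : ∀ x, 2 ≤ x → x ≤ y → ¬ eval c (s x).r) (hL : eval c (s y).L)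
    (her : eval c (s y).e ∨ eval c (s 1).r) : False := by
  have h0 : (delayTerm n s).nihil = ⊥ := congrArg BoolComplex.nihil h
  refine (eval_bot c).1 (h0 ▸ ?_)
  simp only [delayTerm, eval_sup, eval_inf, eval_nabla, eval_compl]
  exact ⟨hK, y, ⟨h2, hy⟩, fun x h1 h3 => ⟨⟨hr x h1 h3, hL⟩, her⟩⟩

/-- A node added by the first production occurs in no later production. -/
theorem not_nodes_of_r (hC : Coherent n s) (hD : delayTerm n s = 0) {i : V}
    (hi : eval (.inr i) (s 1).r) {y : ℕ} (h2 : 2 ≤ y) (hy : y ≤ n) : ¬ (s y).nodes i := by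
  intro hN
  -- Nothing strictly between p₁ and the first occurrence `z` touches the node, so use at `z`
  -- violates the delay term and addition at `z` violates coherence.
  obtain ⟨z, hz2, hzn, -, hz, hmin⟩ := exists_first (P := fun k => (s k).nodes i) h2 hy hN
  have hmin' : ∀ x, 2 ≤ x → x < z →
      ¬ eval (.inr i) (s x).L ∧ ¬ eval (.inr i) (s x).r := fun x h1 h3 => by
    have := hmin x h1 h3
    rwa [eval_nodes, not_or] at this
  rcases (s z).eval_nodes.1 hz with hL | hr
  · refine delayTerm_nihil hD (.inr i) hz2 hzn (eval_K_of_r _ hi) (fun x h1 h3 => ?_) hL (.inr hi)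
    rcases h3.eq_or_lt with rfl | h3
    · exact fun h => not_eval_L_of_r _ h hL
    · exact (hmin' x h1 h3).2
  · exact hC.not_r (.inr i) le_rfl hz2 hzn ((s 1).eval_R.2 (.inl hi))
      (fun x h1 h3 he => (hmin' x h1 h3).1 (eval_L_of_e _ he)) hr

/-- A node deleted by the first production occurs in no later production. -/
theorem not_nodes_of_e (hC : Coherent n s) (hD : delayTerm n s = 0) {i : V}
    (hi : eval (.inr i) (s 1).e) {y : ℕ} (h2 : 2 ≤ y) (hy : y ≤ n) : ¬ (s y).nodes i := by
  intro hN
  obtain ⟨z, hz2, hzn, -, hz, hmin⟩ := exists_first (P := fun k => (s k).nodes i) h2 hy hN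
  have hmin' : ∀ x, 2 ≤ x → x < z →
      ¬ eval (.inr i) (s x).L ∧ ¬ eval (.inr i) (s x).r := fun x h1 h3 => by
    have := hmin x h1 h3
    rwa [eval_nodes, not_or] at this
  -- The roles are exchanged for a deleted node: use at `z` violates coherence, addition violates
  -- the delay term.
  rcases (s z).eval_nodes.1 hz with hL | hr
  · exact hC.not_L (.inr i) le_rfl hz2 hzn hi (fun x h1 h3 => (hmin' x h1 h3).2) hL
  · refine delayTerm_cert hD (.inr i) hz2 hzn (eval_L_of_e _ hi) (fun x h1 h3 he => ?_)
      (eval_K_of_r _ hr) (.inl hr)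
    rcases h3.eq_or_lt with rfl | h3
    · exact not_eval_e_of_r _ hr he
    · exact (hmin' x h1 h3).1 (eval_L_of_e _ he)

theorem eval_run_succ (c : (V × V) ⊕ V) (m : ℕ) (G : BGraph V) :
    eval c (run s (m + 1) G) ↔
      eval c (s (m + 1)).r ∨ ¬ eval c (s (m + 1)).e ∧ eval c (run s m G) := by
  simp [run, Production.apply, eval_sup, eval_inf, eval_compl]

theorem eval_run_of_r_one (c : (V × V) ⊕ V) (G : BGraph V) (hr : eval c (s 1).r) (m : ℕ)
    (he : ∀ x, 2 ≤ x → x ≤ m + 1 → ¬ eval c (s x).e) : eval c (run s (m + 1) G) := by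
  induction m with
  | zero => exact (eval_run_succ c 0 G).2 (.inl hr)
  | succ m ih =>
    exact (eval_run_succ c _ G).2
      (.inr ⟨he _ (by omega) le_rfl, ih fun x h1 h2 => he x h1 (by omega)⟩)

/-- In a compatible sequence, no end node of an edge added by the first production is deleted as
long as the edge is not. -/
theorem Compatible.not_e_of_r_one (h : Compatible n s) {i j : V}
    (hr : eval (.inl (i, j)) (s 1).r) {m : ℕ} (hm : 2 ≤ m) (hmn : m ≤ n)
    (he : ∀ x, 2 ≤ x → x ≤ m → ¬ eval (.inl (i, j)) (s x).e) :
    ¬ eval (.inr i) (s m).e ∧ ¬ eval (.inr j) (s m).e := by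
  obtain ⟨k, rfl⟩ : ∃ k, m = k + 1 := ⟨m - 1, by omega⟩
  -- The edge survives up to position `m`, so compatibility puts its ends in that image; a node
  -- present right after p_m was not deleted by it.
  have hs := h (k + 1) (by omega) hmn i j (eval_run_of_r_one (.inl (i, j)) _ hr k he)
  have aux : ∀ v : V, eval (.inr v) (run s (k + 1) (initialDigraph (k + 1) s).cert) →
      ¬ eval (.inr v) (s (k + 1)).e := fun v hv => by
    rcases (eval_run_succ _ _ _).1 hv with hv | hv
    · exact not_eval_e_of_r _ hv
    · exact hv.1
  exact ⟨aux i hs.1, aux j hs.2⟩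

/-! ### Equality of the initial digraphs under delay -/

theorem cert_delay (hn : 1 ≤ n) (hD : delayTerm n s = 0) :
    (initialDigraph n s).cert = (initialDigraph n (delay n s)).cert := by
  refine eval_ext fun c => ?_
  simp only [initialDigraph, eval_nabla, eval_inf, eval_compl]
  rw [exists_prefix_iff_first hn s (fun p => ¬ eval c p.r) (fun p => eval c p.L),
    exists_prefix_delay_iff hn s (fun p => ¬ eval c p.r) (fun p => eval c p.L)]
  constructor
  · rintro ⟨hr, hL | h⟩
    · by_cases hall : ∀ x, 2 ≤ x → x ≤ n → ¬ eval c (s x).r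
      · exact .inr ⟨hr, hL, hall⟩
      · push Not at hall
        obtain ⟨y, hy2, hyn, hy⟩ := hall
        obtain ⟨z, hz2, hzn, -, hz, hmin⟩ := exists_first (P := fun k => eval c (s k).r) hy2 hyn hy
        by_contra hno
        -- A deletion at `x` would need the entry in `L` at `x`, with no addition up to `x`: this is
        -- Z.
        refine delayTerm_cert hD c hz2 hzn hL (fun x h1 h3 he => hno (.inl ?_))
          (eval_K_of_r _ hz) (.inl hz)
        have hLx := eval_L_of_e _ he
        refine ⟨x, by omega, fun w h4 h5 => ⟨?_, hLx⟩⟩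
        rcases (h5.trans h3).eq_or_lt with rfl | h6
        · obtain rfl : x = w := by omega
          exact absurd he (not_eval_e_of_r _ hz)
        · exact hmin w h4 h6
    · exact .inl h
  · rintro (⟨y, hy, h⟩ | ⟨hr, hL, -⟩)
    · refine ⟨fun hr => ?_, .inr ⟨y, hy, h⟩⟩
      exact delayTerm_nihil hD c hy.1 hy.2 (eval_K_of_r _ hr) (fun x h1 h2 => (h x h1 h2).1)
        (h y hy.1 le_rfl).2 (.inr hr)
    · exact ⟨hr, .inl hL⟩

/-- An edge between nodes of the first production cannot become available through a later one while
it is forbidden by the first production and by none in between. -/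
theorem not_T_of_K_one (hC : Coherent n s) (hM : Compatible n s) (hD : delayTerm n s = 0)
    {c : (V × V) ⊕ V} (hT1 : ¬ eval c (s 1).T) (hK1 : eval c (s 1).K) {z : ℕ} (hz2 : 2 ≤ z)
    (hzn : z ≤ n) (he : ∀ x, 2 ≤ x → x < z → ¬ eval c (s x).e)
    (hK : ∀ x, 2 ≤ x → x < z → ¬ eval c (s x).K) : ¬ eval c (s z).T := by
  intro hT
  obtain ⟨i, j⟩ | i := c
  swap
  · exact not_T_node _ hT
  obtain ⟨⟨hNi, hNj⟩, hadd, -, -⟩ := (s z).T_edge.1 hT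
  -- Either p₁ adds the edge, and its ends stay until `z` and cannot be added again; or p₁ deletes
  -- an end, which then cannot occur at `z`.
  rcases (s 1).eval_K.1 hK1 with hr | ⟨-, hDb⟩
  · obtain ⟨hRi, hRj⟩ := (s 1).R_node_of_r_edge hr
    have key : ∀ v : V, (v = i ∨ v = j) → eval (.inr v) (s 1).R → ¬ eval (.inr v) (s z).r := by
      intro v hv hR
      refine hC.not_r (.inr v) le_rfl hz2 hzn hR fun x h1 h2 hex => ?_
      have := hM.not_e_of_r_one hr h1 (by omega) fun w h3 h4 => he w h3 (by omega)
      rcases hv with rfl | rfl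
      · exact this.1 hex
      · exact this.2 hex
    rcases hadd with h | h
    · exact key i (.inl rfl) hRi h
    · exact key j (.inr rfl) hRj h
  · obtain ⟨-, h | h⟩ := (s 1).Dbar_edge.1 hDb
    · exact not_nodes_of_e hC hD h hz2 hzn hNi
    · exact not_nodes_of_e hC hD h hz2 hzn hNj

theorem nihil_delay (hn : 1 ≤ n) (hC : Coherent n s) (hM : Compatible n s)
    (hD : delayTerm n s = 0) :
    (initialDigraph n s).nihil = (initialDigraph n (delay n s)).nihil := by
  refine eval_ext fun c => ?_
  simp only [initialDigraph, eval_nabla, eval_inf, eval_compl]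
  rw [exists_prefix_iff_first hn s (fun p => ¬ eval c p.e ∧ ¬ eval c p.T) (fun p => eval c p.K),
    exists_prefix_delay_iff hn s (fun p => ¬ eval c p.e ∧ ¬ eval c p.T) (fun p => eval c p.K)]
  constructor
  · rintro ⟨hP, hK | h⟩
    · by_cases hall : ∀ x, 2 ≤ x → x ≤ n → ¬ eval c (s x).e ∧ ¬ eval c (s x).T
      · exact .inr ⟨hP, hK, hall⟩
      · push Not at hall
        obtain ⟨y, hy2, hyn, hy⟩ := hall
        obtain ⟨z, hz2, hzn, -, hz, hmin⟩ := exists_first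
          (P := fun k => ¬ (¬ eval c (s k).e ∧ ¬ eval c (s k).T)) hy2 hyn (by tauto)
        by_contra hno
        -- Before the first blocking position `z`, any entry of `K` would give Z.
        have hKx : ∀ x, 2 ≤ x → x < z → ¬ eval c (s x).K := fun x h1 h2 hKx =>
          hno (.inl ⟨x, by omega, fun w h3 h4 => ⟨not_not.1 (hmin w h3 (by omega)), hKx⟩⟩)
        by_cases he : eval c (s z).e
        · refine delayTerm_nihil hD c hz2 hzn hK (fun x h1 h3 hr => ?_) (eval_L_of_e _ he) (.inl he)
          rcases h3.eq_or_lt with rfl | h3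
          · exact not_eval_e_of_r _ hr he
          · exact hKx x h1 h3 (eval_K_of_r _ hr)
        · exact not_T_of_K_one hC hM hD hP.2 hK hz2 hzn
            (fun x h1 h3 => (not_not.1 (hmin x h1 h3)).1) hKx (by tauto)
    · exact .inl h
  · rintro (⟨y, hy, h⟩ | ⟨hP, hK, -⟩)
    · have hKy := (h y hy.1 le_rfl).2
      refine ⟨⟨fun he => ?_, fun hT => ?_⟩, .inr ⟨y, hy, h⟩⟩
      · exact delayTerm_cert hD c hy.1 hy.2 (eval_L_of_e _ he) (fun x h1 h2 => (h x h1 h2).1.1)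
          hKy (.inr he)
      -- An end of the edge is added by p₁, yet `K` at `y` makes it a node of p_y.
      · obtain ⟨i, j⟩ | i := c
        · obtain ⟨hNi, hNj⟩ := nodes_of_K_edge _ hKy
          obtain ⟨-, hi | hj, -⟩ := (s 1).T_edge.1 hT
          · exact not_nodes_of_r hC hD hi hy.1 hy.2 hNi
          · exact not_nodes_of_r hC hD hj hy.1 hy.2 hNj
        · exact not_T_node _ hT
    · exact ⟨hP, .inl hK⟩

theorem gCongruent_delay (hn : 1 ≤ n) (hC : Coherent n s) (hM : Compatible n s)
    (hD : delayTerm n s = 0) : GCongruent n s (delay n s) :=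
  BoolComplex.ext (cert_delay hn hD) (nihil_delay hn hC hM hD)

/-! ### Reduction of advancement to delay -/

theorem initialDigraph_congr {s' : ℕ → Production V} (h : ∀ k, 1 ≤ k → k ≤ n → s k = s' k) :
    initialDigraph n s = initialDigraph n s' := by
  refine BoolComplex.ext (nabla_congr fun x y h1 h2 h3 => ?_)
    (nabla_congr fun x y h1 h2 h3 => ?_)
  · rw [h x h1 (by omega), h y (by omega) h3]
  · rw [h x h1 (by omega), h y (by omega) h3]

theorem delay_advance {k : ℕ} (hk : 1 ≤ k) : delay n (advance n s) k = s k := by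
  by_cases h : k = n
  · simp [delay, advance, h]
  · simp [delay, advance, h, show k ≠ 0 by omega]

theorem delayTerm_advance (hn : 1 ≤ n) : delayTerm n (advance n s) = advanceTerm n s := by
  obtain ⟨m, rfl⟩ : ∃ m, n = m + 1 := ⟨n - 1, by omega⟩
  have h1 : advance (m + 1) s 1 = s (m + 1) := if_pos rfl
  have hs : ∀ k, 1 ≤ k → advance (m + 1) s (k + 1) = s k := fun k hk => by
    simp [advance, show k ≠ 0 by omega]
  refine BoolComplex.ext ?_ ?_
  · simp only [delayTerm, advanceTerm, h1, nabla_succ_succ 1 m, Nat.add_sub_cancel]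
    congr 1
    refine nabla_congr fun x y h2 h3 h4 => ?_
    rw [hs x h2, hs y (by omega)]
  · simp only [delayTerm, advanceTerm, h1, nabla_succ_succ 1 m, Nat.add_sub_cancel]
    congr 1
    refine nabla_congr fun x y h2 h3 h4 => ?_
    rw [hs x h2, hs y (by omega)]

theorem gCongruent_advance (hn : 1 ≤ n) (hC : Coherent n (advance n s))
    (hM : Compatible n (advance n s)) (hF : advanceTerm n s = 0) :
    GCongruent n s (advance n s) := by
  have h := gCongruent_delay hn hC hM ((delayTerm_advance hn).trans hF)
  -- Delay undoes advancement only from position 1 on, so the sequences are compared on 1 to n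
  -- rather than as functions.
  have h' : initialDigraph n (delay n (advance n s)) = initialDigraph n s :=
    initialDigraph_congr fun k hk _ => delay_advance hk
  exact (Eq.trans h h').symm

end Delay

end MGG

theorem mainTheorem7 {V : Type*} (n : ℕ) (hn : 1 ≤ n) (s : ℕ → MGG.Production V) :
    (MGG.Coherent n (MGG.advance n s) → MGG.Compatible n (MGG.advance n s) →
      MGG.advanceTerm n s = 0 → MGG.GCongruent n s (MGG.advance n s)) ∧
    (MGG.Coherent n s → MGG.Compatible n s →
      MGG.delayTerm n s = 0 → MGG.GCongruent n s (MGG.delay n s)) :=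
  ⟨MGG.gCongruent_advance hn, MGG.gCongruent_delay hn⟩
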